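/- **Theorem 5.1 (label unwinding).** *Rigged configurations and the KKR procedure.* For a diagram $\mu$ (a finite multiset of rows of positive integer widths) let $Q_j$ be the number of its boxes in columns $\le j$. An $\mathfrak{sl}_n$ rigged configuration $\mathrm{RC}=((\mu^{(0)}),(\mu^{(1)},r^{(1)}),\dots,(\mu^{(n-1)},r^{(n-1)}))$ consists of diagrams $\mu^{(0)},\dots,\mu^{(n-1)}$ (with $\mu^{(n)}=\emptyset$) and an integer (rigging) $r$ for each row of $\mu^{(i)}$, $i\ge1$, such that for each row of $\mu^{(i)}$, of width $j$, the vacancy number $p^{(i)}_j=Q^{(i-1)}_j-2Q^{(i)}_j+Q^{(i+1)}_j$ satisfies $0\le r\le p^{(i)}_j$. A row is singular if $r=p^{(i)}_j$. Removing a row of the quantum space $\mu^{(0)}$ by the KKR procedure means removing its boxes one by one from right to left. Together with a box $\alpha^{(0)}$ one removes boxes $\alpha^{(1)},\alpha^{(2)},\dots$, where $\alpha^{(i)}$ is the rightmost box of a shortest row among the singular rows of $\mu^{(i)}$ of width $\ge\mathrm{col}(\alpha^{(i-1)})$ (if there is none, then $\alpha^{(i)}=\alpha^{(i+1)}=\dots=\emptyset$).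 Afterwards the vacancy numbers are recomputed, the shortened rows get their new vacancy numbers as riggings, and the other riggings are kept. The letter produced is $1+\max\{i:\alpha^{(i)}\neq\emptyset\}$, and the letters produced by a row, in order, form a one-row tableau. *KKR normal ordered products.* Let $1\le a\le n-1$ and let $\mathrm{RC}^{(a-1)}=((\mu^{(a-1)}),(\mu^{(a)},r^{(a)}),\dots,(\mu^{(n-1)},r^{(n-1)}))$, with $\mu^{(a-1)}$ as quantum space and with letters $a,\dots,n$ instead of $1,\dots,n-a+1$. Let $\mathrm{RC}^{(a-1)}_+$ be obtained from it by replacing the quantum space by $\mu^{(a-1)}\cup\mu^{(a)}\cup(1^L)$, with $L$ so large that no row of $\mu^{(a)}$ becomes singular while the part $\mu^{(a-1)}$ is being removed. Remove the rows of $\mu^{(a-1)}$ (in any order). Then repeat the following until no row of $\mu^{(a)}$ is left: for $k=1,2,\dots$, remove boxes of the part $(1^L)$ of the quantum space one by one until some row of $\mu^{(a)}$ is singular, and let $d_k$ be the number of boxes left in this part; choose any singular row of $\mu^{(a)}$, and remove the row of the same width from the copy of $\mu^{(a)}$ in the quantum space, which gives a tableau $b_k$ (and removes the chosen row too). The result $b_N[d_N]\otimes\cdots\otimes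 b_2[d_2]\otimes b_1[d_1]$ is called a KKR normal ordered product; $b_k$ originates from the row chosen at step $k$. Rows of $\mu^{(a)}$ that are singular simultaneously are said to be in collision state. *Winding and unwinding numbers.* For tableaux $x,y$ with $|x|\ge|y|$ letters, connect the letters of $y$, one after another, with letters of $x$ not yet used: a letter $c$ of $y$ is connected with the largest remaining letter of $x$ that is $<c$ (an unwinding pair), or, if there is none, with the largest remaining letter of $x$ (a winding pair). If $|x|<|y|$, use the mirrored rule: a letter $c$ of $x$ is connected with the smallest remaining letter of $y$ that is $>c$ (unwinding), or, if there is none, with the smallest remaining letter of $y$ (winding). The unwinding number of $x\otimes y$ is the number of unwinding pairs, and the energy $H(x\otimes y)$ is the number of winding pairs. *Statement.* Let $\cdots\otimes B[d_2]\otimes A[d_1]$ be the two rightmost factors of a KKR normal ordered product obtained from $\mathrm{RC}^{(a-1)}_+$, with $|B|=M$, and call the rows of $\mu^{(a)}$ they originate from row $A$ and row $B$. Let $$\Delta Q^{(a+1)}_M:=(Q^{(a+1)}_M\text{ just before the removal of row }A)-(Q^{(a+1)}_M\text{ just after the removal of row }A),$$ which is the number of boxes removed from the columns $\le M$ of $\mu^{(a+1)}$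 when row $A$ is removed. Then $$\Delta Q^{(a+1)}_M=\text{the unwinding number of }B\otimes A .$$ As a consequence, if rows $A$ and $B$ are in collision state just before row $A$ is removed, then $d_1-d_2=H(B\otimes A)$. -/

import Mathlib

namespace KKR

/-- The data `((μ⁽⁰⁾), (μ⁽¹⁾, r⁽¹⁾), (μ⁽²⁾, r⁽²⁾), …)`. Rows of a diagram are unordered (rows of the same
width are always listed by increasing rigging), so every diagram is a multiset of rows.
`quantum` is the multiset of the widths of the rows of `μ⁽⁰⁾`, and `rows i` is the multiset of pairs
(width, rigging) of the rows of `μ⁽ⁱ⁺¹⁾`. -/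
structure RC where
  quantum : Multiset ℕ
  rows : ℕ → Multiset (ℕ × ℤ)

/-- `Q_j` of a single diagram: the number of boxes in columns `≤ j`. -/
def boxes (μ : Multiset ℕ) (j : ℕ) : ℕ := (μ.map fun w => min j w).sum

/-- The vacancy number `p_j⁽ⁱ⁺¹⁾ = Q_j⁽ⁱ⁾ - 2 Q_j⁽ⁱ⁺¹⁾ + Q_j⁽ⁱ⁺²⁾` of a sequence of diagrams. -/
def vacancy (μ : ℕ → Multiset ℕ) (i j : ℕ) : ℤ :=
  (boxes (μ i) j : ℤ) - 2 * boxes (μ (i + 1)) j + boxes (μ (i + 2)) j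

/-- Remove the rightmost box of a row of width `c` (`⊤` means that no box is removed).
A row of width one disappears. -/
def shrink (μ : Multiset ℕ) : WithTop ℕ → Multiset ℕ
  | none => μ
  | some c => μ.erase c + (if c ≤ 1 then 0 else {c - 1})

namespace RC

/-- The diagram `μ⁽ⁱ⁾`, without riggings. -/
def shape (S : RC) : ℕ → Multiset ℕ
  | 0 => S.quantum
  | i + 1 => (S.rows i).map Prod.fst

/-- `Q_j⁽ⁱ⁾`. -/
def Q (S : RC) (i j : ℕ) : ℕ := boxes (S.shape i) j

/-- A row `x = (width, rigging)` of `μ⁽ⁱ⁺¹⁾` is singular: its rigging equals its vacancy number. -/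
def Singular (S : RC) (i : ℕ) (x : ℕ × ℤ) : Prop := x.2 = vacancy S.shape i x.1

instance (S : RC) (i : ℕ) (x : ℕ × ℤ) : Decidable (S.Singular i x) :=
  inferInstanceAs (Decidable (x.2 = vacancy S.shape i x.1))

/-- `S` is an `𝔰𝔩ₙ` rigged configuration: the diagrams are `μ⁽⁰⁾, …, μ⁽ⁿ⁻¹⁾`, all rows have positive
width, all vacancy numbers of rows are nonnegative, and every rigging lies between `0` and the
vacancy number of its row. -/
structure IsRigged (n : ℕ) (S : RC) : Prop where
  quantum_pos : ∀ w ∈ S.quantum, 0 < w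
  rows_pos : ∀ i, ∀ x ∈ S.rows i, 0 < x.1
  rows_eq_zero : ∀ i, n ≤ i + 1 → S.rows i = 0
  vacancy_nonneg : ∀ i, ∀ x ∈ S.rows i, 0 ≤ vacancy S.shape i x.1
  rigging_nonneg : ∀ i, ∀ x ∈ S.rows i, 0 ≤ x.2
  rigging_le : ∀ i, ∀ x ∈ S.rows i, x.2 ≤ vacancy S.shape i x.1

/-! ### The KKR procedure -/

/-- `S.col c i` is the column of the box `α⁽ⁱ⁾` which is chosen when the rightmost box of a row of
width `c` of the quantum space is removed; `⊤` stands for `α⁽ⁱ⁾ = ∅`. In `μ⁽ⁱ⁺¹⁾` one takes a shortest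
row among the singular rows of width at least the column of `α⁽ⁱ⁾`; once there is none, all later
boxes are empty too. (Singular rows of the same width have the same rigging, so the choice among the
shortest ones does not matter.) -/
def col (S : RC) (c : ℕ) : ℕ → WithTop ℕ
  | 0 => (c : WithTop ℕ)
  | i + 1 =>
    (((S.rows i).filter fun x => S.col c i ≤ (x.1 : WithTop ℕ) ∧ S.Singular i x).map
      fun x => (x.1 : WithTop ℕ)).inf

/-- The diagrams after the boxes `α⁽⁰⁾, α⁽¹⁾, …` have been removed. -/
def shapeAfter (S : RC) (c i : ℕ) : Multiset ℕ := shrink (S.shape i) (S.col c i)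

/-- One box of the quantum space, the rightmost box of a row of width `c`, is removed together with
the boxes `α⁽¹⁾, α⁽²⁾, …`. Rows from which no box is removed keep their riggings, and a row from which
a box is removed gets the new vacancy number of the shortened row as its rigging. -/
def removeBox (c : ℕ) (S : RC) : RC where
  quantum := S.shapeAfter c 0
  rows i :=
    match S.col c (i + 1) with
    | none => S.rows i
    | some w => (S.rows i).erase (w, vacancy S.shape i w) +
        (if w ≤ 1 then 0 else {(w - 1, vacancy (S.shapeAfter c) i (w - 1))})

/-- The letter produced by the removal of one box, for a configuration with diagrams
`μ⁽⁰⁾, …, μ⁽ᵏ⁾` and letters starting from `a`: it is `a + max {i ≤ k | α⁽ⁱ⁾ ≠ ∅}`. -/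
def letter (a k c : ℕ) (S : RC) : ℕ := a + Nat.findGreatest (fun i => S.col c i ≠ ⊤) k

/-- The configuration after a whole row of width `c` of the quantum space has been removed, box by
box from right to left. -/
def removeRow : ℕ → RC → RC
  | 0, S => S
  | c + 1, S => removeRow c (S.removeBox (c + 1))

/-- The tableau (the letters from left to right) obtained by removing a row of width `c` of the
quantum space. -/
def tableau (a k : ℕ) : ℕ → RC → List ℕ
  | 0, _ => []
  | c + 1, S => S.letter a k (c + 1) :: tableau a k c (S.removeBox (c + 1))

/-- The configuration after rows of the given widths of the quantum space have been removed one after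
another. -/
def removeRows : List ℕ → RC → RC
  | [], S => S
  | c :: cs, S => removeRows cs (S.removeRow c)

/-- No row of `μ⁽¹⁾` is singular. -/
def NoneSingular (S : RC) : Prop := ∀ x ∈ S.rows 0, ¬ S.Singular 0 x

/-- No row of `μ⁽¹⁾` is singular at any moment at which a box of a row of width `c` is about to be
removed, while that row is removed. -/
def QuietRow : ℕ → RC → Prop
  | 0, _ => True
  | c + 1, S => S.NoneSingular ∧ QuietRow c (S.removeBox (c + 1))

/-- The same for rows of the given widths which are removed one after another. -/
def QuietRows : List ℕ → RC → Prop
  | [], _ => True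
  | c :: cs, S => QuietRow c S ∧ QuietRows cs (S.removeRow c)

/-! ### KKR normal ordered products -/

/-- `RC⁽ᵇ⁾ = ((μ⁽ᵇ⁾), (μ⁽ᵇ⁺¹⁾, r⁽ᵇ⁺¹⁾), …)`; its `i`-th diagram is `μ⁽ᵇ⁺ⁱ⁾`. -/
def truncate (R : RC) (b : ℕ) : RC where
  quantum := R.shape b
  rows i := R.rows (b + i)

/-- The modified configuration, with quantum space `μ⁽⁰⁾ ∪ μ⁽¹⁾ ∪ (1ᴸ)`. -/
def plus (S : RC) (L : ℕ) : RC where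
  quantum := S.quantum + S.shape 1 + Multiset.replicate L 1
  rows := S.rows

end RC

/-- A factor `b[d]` of a KKR normal ordered product, with the row of `μ⁽¹⁾` (width and rigging) it
originates from and the configurations just before and just after this row is removed. -/
structure Factor where
  row : ℕ × ℤ
  tableau : List ℕ
  mode : ℕ
  before : RC
  after : RC

/-- `ΔQ_j⁽ⁱ⁾`: the value of `Q_j⁽ⁱ⁾` just before minus its value just after the removal of the row. -/
def Factor.deltaQ (f : Factor) (i j : ℕ) : ℤ := (f.before.Q i j : ℤ) - f.after.Q i j

/-- `Removal a k S d fs`: the quantum space of `S` is `μ⁽¹⁾ ∪ (1ᵈ)`, and `fs` (from right to left in the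
product) can be obtained by repeating the following: remove boxes of `(1ᵈ)` one by one until some row
of `μ⁽¹⁾` is singular, `(1ᵉ)` being left; choose any singular row `x` of `μ⁽¹⁾`; remove the row of the
same width from the quantum space (which removes `x` too); if this gives the tableau `b`, the next
factor is `b[e]`. The repetition ends when all rows of `μ⁽¹⁾` are removed. -/
inductive Removal (a k : ℕ) : RC → ℕ → List Factor → Prop
  | nil {S : RC} {d : ℕ} (h : S.rows 0 = 0) : Removal a k S d []
  | cons {S T : RC} {d e : ℕ} {x : ℕ × ℤ} {fs : List Factor}
      (le : e ≤ d)
      (quiet : S.QuietRows (List.replicate (d - e) 1))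
      (eq : T = S.removeRows (List.replicate (d - e) 1))
      (mem : x ∈ T.rows 0)
      (singular : T.Singular 0 x)
      (next : Removal a k (T.removeRow x.1) e fs) :
      Removal a k S d
        ({ row := x
           tableau := T.tableau a k x.1
           mode := e
           before := T
           after := T.removeRow x.1 } :: fs)

/-- `fs = [b₁[d₁], b₂[d₂], …, b_N[d_N]]` is a KKR normal ordered product
`b_N[d_N] ⊗ ⋯ ⊗ b₂[d₂] ⊗ b₁[d₁]` obtained from the modification of `RC⁽ᵃ⁻¹⁾`, with letters `a, …, n`, where
`R` is an `𝔰𝔩ₙ` rigged configuration: the part `μ⁽ᵃ⁻¹⁾` of the quantum space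
`μ⁽ᵃ⁻¹⁾ ∪ μ⁽ᵃ⁾ ∪ (1ᴸ)` is removed first, in some order `cs` of its rows, where `L` is so large that no row
of `μ⁽ᵃ⁾` becomes singular in the course of it, and then the remaining part is removed as in
`Removal`. -/
def IsNormalOrdered (n a : ℕ) (R : RC) (fs : List Factor) : Prop :=
  ∃ (L : ℕ) (cs : List ℕ), (cs : Multiset ℕ) = R.shape (a - 1) ∧
    ((R.truncate (a - 1)).plus L).QuietRows cs ∧
    Removal a (n - a) (((R.truncate (a - 1)).plus L).removeRows cs) L fs

/-- Two rows of `μ⁽¹⁾` are in collision state: they are simultaneously singular. -/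
def Collision (S : RC) (x y : ℕ × ℤ) : Prop :=
  ({x, y} : Multiset (ℕ × ℤ)) ≤ S.rows 0 ∧ S.Singular 0 x ∧ S.Singular 0 y

/-! ### Winding and unwinding numbers

Elements of the crystals are given by the lists of their letters. The diagram of `x ⊗ y` has the
letters of `x` in the left column and those of `y` in the right column, the letter `1` being highest.
The functions below return (number of winding pairs, number of unwinding pairs). -/

/-- The rule for `|x| ≥ |y|`: every dot of the right column is connected with the lowest dot among
the remaining dots of the left column which are strictly higher (unwinding), and with the lowest one
of all remaining dots of the left column if there is no such dot (winding). -/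
def pairRight (x : List ℕ) : List ℕ → ℕ × ℕ
  | [] => (0, 0)
  | b :: y =>
    match (x.filter (· < b)).max? with
    | some c => let p := pairRight (x.erase c) y; (p.1, p.2 + 1)
    | none =>
      match x.max? with
      | some c => let p := pairRight (x.erase c) y; (p.1 + 1, p.2)
      | none => (0, 0)

/-- The mirrored rule for `|x| < |y|`: every dot of the left column is connected with the highest dot
among the remaining dots of the right column which are strictly lower (unwinding), and with the
highest one of all remaining dots of the right column if there is no such dot (winding). -/
def pairLeft (y : List ℕ) : List ℕ → ℕ × ℕ
  | [] => (0, 0)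
  | b :: x =>
    match (y.filter (b < ·)).min? with
    | some c => let p := pairLeft (y.erase c) x; (p.1, p.2 + 1)
    | none =>
      match y.min? with
      | some c => let p := pairLeft (y.erase c) x; (p.1 + 1, p.2)
      | none => (0, 0)

/-- The numbers of winding and of unwinding pairs of `x ⊗ y`. -/
def pairs (x y : List ℕ) : ℕ × ℕ := if y.length ≤ x.length then pairRight x y else pairLeft y x

/-- The unwinding number of `x ⊗ y`. -/
def unwindingNumber (x y : List ℕ) : ℕ := (pairs x y).2

/-- The energy `H(x ⊗ y)`: the winding number of `x ⊗ y`. -/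
def energy (x y : List ℕ) : ℕ := (pairs x y).1

end KKR

/-!
Everything is local in the level `k` of the diagrams. Let a row of width `l` be removed from the quantum
space, and then one of width `m`; let `hits k j` count the boxes that leave the columns `≤ j` of `μ⁽ᵏ⁾`
during such a removal. Successive boxes removed from one diagram move strictly to the left
(`col_removeBox_lt`), because a shortened row is singular.

*One removal.* The slack of a row is its vacancy number minus its rigging. A row `x` of `μ⁽ᵏ⁺¹⁾` of width
`c` loses one unit of slack for every box that is taken to the left of its end in `μ⁽ᵏ⁾` but to the right
of it in `μ⁽ᵏ⁺¹⁾`, and when the slack is used up such boxes no longer exist. So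
`hits k c - hits (k + 1) c` is at most the slack before the removal (`hits_sub_hits_le_slack`), with
equality for a suitable row of width `c` if a run of columns `…, c - 1, c` losing boxes ends at `c`
(`exists_slack_le_hits_sub_hits`). After the removal the slack is at least
`hits (k + 1) c - hits (k + 2) c` (`hits_sub_hits_le_slack_removeRow`), with equality for a suitable row
if a run of columns losing boxes begins at `c + 1` (`exists_slack_removeRow_eq`).

*Two removals.* Let `f k j` (`excess`) be `hits k j` for the second removal minus `hits (k + 1) j` for
the first. The four facts give `f (k + 1) c ≤ f k c` where a run for the second removal ends, and
`f k c ≤ f (k + 1) c` where a run for the first removal begins. Hence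
`max_j f k j = max (f k ∞) (max_j f (k + 1) j)`, and by iteration `max_j f 1 j = max_k f k ∞`
(`excess_max`).

*Letters.* If the rows removed are the ones that belong to singular rows of `μ⁽¹⁾`, then
`max_j f 1 j = m - hits 2 m`, where `hits 2 m` refers to the first removal. On the other side,
`f k ∞` compares numbers of letters of the two tableaux above thresholds, and `m - max_k f k ∞` is the
minimal size of a threshold vertex cover of the graph that joins the letters of the second tableau to
the larger letters of the first one (`cover_tableau`). The greedy rule for unwinding pairs produces a
matching of just this size (`isMinCover_unwindingNumber`), as in König's theorem.

*Energy.* With the quantum space `μ⁽¹⁾ ∪ (1ᵈ)` the vacancy numbers of `μ⁽¹⁾` are `d - Q⁽¹⁾ + Q⁽²⁾`. A row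
of width `m` that is singular before and after the removal of a row of width `l` has the same vacancy
number both times, so `d` drops by `min l m` minus the unwinding number, which is the winding number.
-/

namespace KKR

/-! ### Removal of one box -/

lemma natCast_le_natCast {v w : ℕ} : (v : WithTop ℕ) ≤ (w : WithTop ℕ) ↔ v ≤ w := by
  exact_mod_cast Iff.rfl

lemma inf_eq_top_or_mem (s : Multiset (WithTop ℕ)) : s.inf = ⊤ ∨ s.inf ∈ s := by
  induction s using Multiset.induction with
  | empty => simp
  | cons a s ih =>
    right
    rw [Multiset.inf_cons]
    rcases le_total a s.inf with h | h
    · simp [h]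
    · rw [inf_eq_right.2 h]
      rcases ih with h' | h'
      · have : a = ⊤ := by simpa [h'] using h
        simp [this, h']
      · exact Multiset.mem_cons_of_mem h'

lemma boxes_shrink {μ : Multiset ℕ} {w : ℕ} (hw : w ∈ μ) (hpos : 1 ≤ w) (j : ℕ) :
    boxes (shrink μ (w : WithTop ℕ)) j + (if w ≤ j then 1 else 0) = boxes μ j := by
  obtain ⟨ν, rfl⟩ := Multiset.exists_cons_of_mem hw
  change boxes ((w ::ₘ ν).erase w + (if w ≤ 1 then 0 else {w - 1})) j + _ = _
  simp only [boxes, Multiset.erase_cons_head, Multiset.map_add, Multiset.sum_add,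
    Multiset.map_cons, Multiset.sum_cons]
  split_ifs <;> simp <;> omega

namespace RC

variable {S : RC} {c k j w : ℕ} {x : ℕ × ℤ}

lemma col_succ_spec (hw : S.col c (k + 1) = (w : WithTop ℕ)) :
    (w, vacancy S.shape k w) ∈ S.rows k ∧ S.col c k ≤ (w : WithTop ℕ) := by
  have h := inf_eq_top_or_mem (((S.rows k).filter fun x => S.col c k ≤ (x.1 : WithTop ℕ) ∧
    S.Singular k x).map fun x => (x.1 : WithTop ℕ))
  change S.col c (k + 1) = ⊤ ∨ S.col c (k + 1) ∈ _ at h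
  rw [hw] at h
  rcases h with h | h
  · simp at h
  · obtain ⟨⟨v, r⟩, hx, hxw⟩ := Multiset.mem_map.1 h
    obtain ⟨hx1, hx2, hx3⟩ := Multiset.mem_filter.1 hx
    obtain rfl : v = w := by simpa using hxw
    have : r = vacancy S.shape k v := hx3
    subst this
    exact ⟨hx1, hx2⟩

lemma col_succ_le (hx : x ∈ S.rows k) (hcol : S.col c k ≤ (x.1 : WithTop ℕ))
    (hs : S.Singular k x) : S.col c (k + 1) ≤ (x.1 : WithTop ℕ) :=
  Multiset.inf_le (Multiset.mem_map_of_mem _ (Multiset.mem_filter.2 ⟨hx, hcol, hs⟩))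

lemma col_le_col_succ (S : RC) (c k : ℕ) : S.col c k ≤ S.col c (k + 1) := by
  cases h : S.col c (k + 1) with
  | top => exact le_top
  | coe w => exact (col_succ_spec h).2

lemma col_mono (S : RC) (c : ℕ) : Monotone (S.col c) :=
  monotone_nat_of_le_succ (S.col_le_col_succ c)

lemma le_col (S : RC) (c k : ℕ) : (c : WithTop ℕ) ≤ S.col c k :=
  S.col_mono c (Nat.zero_le k)

lemma rows_removeBox_top (h : S.col c (k + 1) = ⊤) : (S.removeBox c).rows k = S.rows k := by
  change (match S.col c (k + 1) with
    | none => _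
    | some w => _) = _
  rw [h]

lemma rows_removeBox_coe (h : S.col c (k + 1) = (w : WithTop ℕ)) :
    (S.removeBox c).rows k = (S.rows k).erase (w, vacancy S.shape k w) +
      (if w ≤ 1 then 0 else {(w - 1, vacancy (S.shapeAfter c) k (w - 1))}) := by
  change (match S.col c (k + 1) with
    | none => _
    | some w => _) = _
  rw [h]
  rfl

lemma shape_removeBox (S : RC) (c : ℕ) : (S.removeBox c).shape = S.shapeAfter c := by
  funext k
  cases k with
  | zero => rfl
  | succ k =>
    change ((S.removeBox c).rows k).map Prod.fst =
      shrink ((S.rows k).map Prod.fst) (S.col c (k + 1))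
    cases h : S.col c (k + 1) with
    | top => rw [rows_removeBox_top h]; rfl
    | coe w =>
      rw [rows_removeBox_coe h]
      obtain ⟨ν, hν⟩ := Multiset.exists_cons_of_mem (col_succ_spec h).1
      change _ = ((S.rows k).map Prod.fst).erase w + (if w ≤ 1 then 0 else {w - 1})
      rw [hν]
      split_ifs <;> simp

/-- Indicator of the event that the box removed from `μ⁽ᵏ⁾` lies in a column `≤ j`. -/
def hit (S : RC) (c k j : ℕ) : ℕ := if S.col c k ≤ (j : WithTop ℕ) then 1 else 0

lemma Q_removeBox (S : RC) (hc : 1 ≤ c) (hk : 1 ≤ k) (j : ℕ) :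
    (S.removeBox c).Q k j + S.hit c k j = S.Q k j := by
  obtain ⟨k, rfl⟩ : ∃ m, k = m + 1 := ⟨k - 1, by omega⟩
  simp only [Q, shape_removeBox, hit, shapeAfter]
  cases h : S.col c (k + 1) with
  | top => simp; rfl
  | coe w =>
    have hw : c ≤ w := by
      have := S.le_col c (k + 1)
      rw [h] at this
      exact natCast_le_natCast.1 this
    have := boxes_shrink (Multiset.mem_map_of_mem Prod.fst (col_succ_spec h).1) (hc.trans hw) j
    simpa [shape] using this

/-- The amount by which the vacancy number of a row of `μ⁽ᵏ⁺¹⁾` exceeds its rigging. -/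
def slack (S : RC) (k : ℕ) (x : ℕ × ℤ) : ℤ := vacancy S.shape k x.1 - x.2

lemma singular_iff_slack : S.Singular k x ↔ S.slack k x = 0 := by
  simp only [Singular, slack]
  constructor <;> intro h <;> omega

lemma slack_removeBox (S : RC) (hc : 1 ≤ c) (hk : 1 ≤ k) (x : ℕ × ℤ) :
    (S.removeBox c).slack k x = S.slack k x - S.hit c k x.1 + 2 * S.hit c (k + 1) x.1
      - S.hit c (k + 2) x.1 := by
  have h0 := S.Q_removeBox hc hk x.1
  have h1 := S.Q_removeBox hc (k := k + 1) (by omega) x.1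
  have h2 := S.Q_removeBox hc (k := k + 2) (by omega) x.1
  simp only [Q] at h0 h1 h2
  simp only [slack, vacancy, ← h0, ← h1, ← h2]
  push_cast
  ring

lemma mem_removeBox_of_ne (hx : x ∈ S.rows k) (h : S.col c (k + 1) ≠ (x.1 : WithTop ℕ)) :
    x ∈ (S.removeBox c).rows k := by
  cases h' : S.col c (k + 1) with
  | top => rwa [rows_removeBox_top h']
  | coe w =>
    rw [rows_removeBox_coe h']
    refine Multiset.mem_add.2 (Or.inl ((Multiset.mem_erase_of_ne ?_).2 hx))
    rintro rfl
    exact h h'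

/-- A shortened row is present, and singular, after the removal of the box. -/
lemma shortened_mem (h : S.col c (k + 1) = (w : WithTop ℕ)) (hw : 2 ≤ w) :
    ∃ r, (w - 1, r) ∈ (S.removeBox c).rows k ∧ (S.removeBox c).Singular k (w - 1, r) := by
  refine ⟨vacancy (S.shapeAfter c) k (w - 1), ?_, ?_⟩
  · rw [rows_removeBox_coe h, if_neg (by omega)]
    simp
  · simp [Singular, shape_removeBox]

lemma mem_or_of_mem_removeBox (hx : x ∈ (S.removeBox c).rows k) :
    x ∈ S.rows k ∨ (S.col c (k + 1) = ((x.1 + 1 : ℕ) : WithTop ℕ) ∧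
      (S.removeBox c).Singular k x) := by
  cases h : S.col c (k + 1) with
  | top => rw [rows_removeBox_top h] at hx; exact Or.inl hx
  | coe w =>
    rw [rows_removeBox_coe h] at hx
    rcases Multiset.mem_add.1 hx with hx | hx
    · exact Or.inl (Multiset.mem_of_mem_erase hx)
    · split_ifs at hx with hw
      · simp at hx
      · rw [Multiset.mem_singleton] at hx
        subst hx
        right
        refine ⟨?_, ?_⟩
        · have : w - 1 + 1 = w := by omega
          simp only [this]; rfl
        · simp [Singular, shape_removeBox]

/-- The boxes removed together with successive boxes of a row move strictly to the left, because a
shortened row is singular. -/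
lemma col_removeBox_lt (hc : 1 ≤ c) (k : ℕ) :
    ∀ w : ℕ, S.col (c + 1) k = (w : WithTop ℕ) →
      (S.removeBox (c + 1)).col c k ≤ ((w - 1 : ℕ) : WithTop ℕ) := by
  induction k with
  | zero =>
    intro w h
    have : c + 1 = w := by
      have : ((c + 1 : ℕ) : WithTop ℕ) = w := h
      exact_mod_cast this
    subst this
    exact le_rfl
  | succ k ih =>
    intro w h
    have hle := (col_succ_spec h).2
    have hw : c + 1 ≤ w := by
      have := S.le_col (c + 1) (k + 1)
      rw [h] at this
      exact natCast_le_natCast.1 this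
    obtain ⟨v, hv⟩ := WithTop.ne_top_iff_exists.1 (ne_top_of_le_ne_top (WithTop.coe_ne_top) hle)
    have hvw : v ≤ w := by rw [← hv] at hle; exact natCast_le_natCast.1 hle
    obtain ⟨r, hr, hs⟩ := shortened_mem h (by omega)
    refine col_succ_le hr ((ih v hv.symm).trans ?_) hs
    exact_mod_cast Nat.sub_le_sub_right hvw 1

/-! ### Removal of a row -/

/-- The number of boxes in columns `≤ j` that leave `μ⁽ᵏ⁾` while a row of width `c` of the quantum
space is removed. -/
def hits (k j : ℕ) : ℕ → RC → ℕ
  | 0, _ => 0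
  | c + 1, S => S.hit (c + 1) k j + hits k j c (S.removeBox (c + 1))

/-- The total number of boxes that leave `μ⁽ᵏ⁾` while a row of width `c` of the quantum space is
removed. -/
def total (k : ℕ) : ℕ → RC → ℕ
  | 0, _ => 0
  | c + 1, S => (if S.col (c + 1) k ≠ ⊤ then 1 else 0) + total k c (S.removeBox (c + 1))

lemma hit_of_le (h : S.col c k ≤ (j : WithTop ℕ)) : S.hit c k j = 1 := if_pos h

lemma hit_of_not_le (h : ¬ S.col c k ≤ (j : WithTop ℕ)) : S.hit c k j = 0 := if_neg h

lemma hits_eq_length (c : ℕ) : ∀ {S : RC}, (1 ≤ c → S.col c k ≤ (j : WithTop ℕ)) →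
    hits k j c S = c := by
  induction c with
  | zero => intros; rfl
  | succ c ih =>
    intro S h
    have h1 := h (by omega)
    obtain ⟨v, hv⟩ := WithTop.ne_top_iff_exists.1 (ne_top_of_le_ne_top (WithTop.coe_ne_top) h1)
    have hvj : v ≤ j := by rw [← hv] at h1; exact natCast_le_natCast.1 h1
    rw [hits, hit_of_le h1, ih, add_comm]
    intro hc
    refine (col_removeBox_lt hc k v hv.symm).trans ?_
    exact_mod_cast (Nat.sub_le v 1).trans hvj

/-- Once a box in a column `≤ j + 1` is removed, all later boxes lie in columns `≤ j`. -/
lemma hits_removeBox (h : S.col (c + 1) k ≤ ((j + 1 : ℕ) : WithTop ℕ)) :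
    hits k j c (S.removeBox (c + 1)) = c := by
  obtain ⟨v, hv⟩ := WithTop.ne_top_iff_exists.1 (ne_top_of_le_ne_top (WithTop.coe_ne_top) h)
  have hvj : v ≤ j + 1 := by rw [← hv] at h; exact natCast_le_natCast.1 h
  refine hits_eq_length c fun hc => (col_removeBox_lt hc k v hv.symm).trans ?_
  exact_mod_cast (by omega : v - 1 ≤ j)

lemma hit_le_one (S : RC) (c k j : ℕ) : S.hit c k j ≤ 1 := by
  unfold hit; split_ifs <;> simp

lemma hits_le (k j c : ℕ) (S : RC) : hits k j c S ≤ c := by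
  induction c generalizing S with
  | zero => rfl
  | succ c ih =>
    have := ih (S.removeBox (c + 1))
    have := S.hit_le_one (c + 1) k j
    rw [hits]; omega

lemma hit_mono (S : RC) (c k : ℕ) {i j : ℕ} (h : i ≤ j) : S.hit c k i ≤ S.hit c k j := by
  unfold hit
  have : (i : WithTop ℕ) ≤ j := by exact_mod_cast h
  split_ifs with h1 h2
  · rfl
  · exact absurd (h1.trans this) h2
  · simp
  · rfl

lemma hit_succ_le (S : RC) (c k j : ℕ) : S.hit c (k + 1) j ≤ S.hit c k j := by
  unfold hit
  split_ifs with h1 h2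
  · rfl
  · exact absurd ((S.col_le_col_succ c k).trans h1) h2
  · simp
  · rfl

lemma hits_mono (k c : ℕ) (S : RC) {i j : ℕ} (h : i ≤ j) : hits k i c S ≤ hits k j c S := by
  induction c generalizing S with
  | zero => rfl
  | succ c ih => exact add_le_add (S.hit_mono _ _ h) (ih _)

lemma hits_succ_le (k j c : ℕ) (S : RC) : hits (k + 1) j c S ≤ hits k j c S := by
  induction c generalizing S with
  | zero => rfl
  | succ c ih => exact add_le_add (S.hit_succ_le _ _ _) (ih _)

lemma hits_zero (k c : ℕ) (S : RC) : hits k 0 c S = 0 := by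
  induction c generalizing S with
  | zero => rfl
  | succ c ih =>
    rw [hits, ih, hit_of_not_le]
    intro h
    have := (S.le_col (c + 1) k).trans h
    norm_cast at this

/-- At most one box leaves every column. -/
lemma hits_add_one_le (k j c : ℕ) (S : RC) : hits k (j + 1) c S ≤ hits k j c S + 1 := by
  induction c generalizing S with
  | zero => simp [hits]
  | succ c ih =>
    by_cases h : S.col (c + 1) k ≤ ((j + 1 : ℕ) : WithTop ℕ)
    · have := hits_removeBox h
      have := hits_le k (j + 1) (c + 1) S
      rw [hits.eq_def k j]
      simp only
      omega
    · rw [hits, hit_of_not_le h, hits]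
      have := ih (S.removeBox (c + 1))
      omega

lemma exists_hits_eq_total (k c : ℕ) (S : RC) : ∃ N, ∀ j, N ≤ j → hits k j c S = total k c S := by
  induction c generalizing S with
  | zero => exact ⟨0, fun _ _ => rfl⟩
  | succ c ih =>
    obtain ⟨N, hN⟩ := ih (S.removeBox (c + 1))
    cases h : S.col (c + 1) k with
    | top => exact ⟨N, fun j hj => by simp [hits, total, hit, h, hN j hj]⟩
    | coe w =>
      refine ⟨max N w, fun j hj => ?_⟩
      have : w ≤ j := (le_max_right _ _).trans hj
      simp [hits, total, hit, h, hN j ((le_max_left _ _).trans hj), this]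

lemma Q_removeRow (hk : 1 ≤ k) (j c : ℕ) (S : RC) :
    (S.removeRow c).Q k j + hits k j c S = S.Q k j := by
  induction c generalizing S with
  | zero => rfl
  | succ c ih =>
    have := ih (S.removeBox (c + 1))
    have := S.Q_removeBox (c := c + 1) (by omega) hk j
    rw [hits, removeRow]; omega

lemma slack_removeRow (hk : 1 ≤ k) (x : ℕ × ℤ) (c : ℕ) (S : RC) :
    (S.removeRow c).slack k x = S.slack k x - hits k x.1 c S + 2 * hits (k + 1) x.1 c S
      - hits (k + 2) x.1 c S := by
  have h0 := Q_removeRow hk x.1 c S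
  have h1 := Q_removeRow (k := k + 1) (by omega) x.1 c S
  have h2 := Q_removeRow (k := k + 2) (by omega) x.1 c S
  simp only [Q] at h0 h1 h2
  simp only [slack, vacancy, ← h0, ← h1, ← h2]
  push_cast
  ring

/-- Every box which leaves `μ⁽ᵏ⁾` to the left of the end of a row `x` of `μ⁽ᵏ⁺¹⁾`, while the
corresponding box of `μ⁽ᵏ⁺¹⁾` lies to the right of it, costs `x` one unit of slack. -/
lemma hits_sub_hits_le_slack (hk : 1 ≤ k) (x : ℕ × ℤ) (c : ℕ) :
    ∀ {S : RC}, x ∈ S.rows k → 0 ≤ S.slack k x →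
      (hits k x.1 c S : ℤ) - hits (k + 1) x.1 c S ≤ S.slack k x := by
  induction c with
  | zero => intro S _ h; simpa [hits] using h
  | succ c ih =>
    intro S hx h
    by_cases h1 : S.col (c + 1) (k + 1) ≤ (x.1 : WithTop ℕ)
    · rw [hits_eq_length (c + 1) (fun _ => h1),
        hits_eq_length (c + 1) (fun _ => (S.col_le_col_succ _ _).trans h1)]
      simpa using h
    · have hx' := mem_removeBox_of_ne hx (fun h => h1 h.le)
      have hs := S.slack_removeBox (c := c + 1) (by omega) hk x
      have h2 : ¬ S.col (c + 1) (k + 2) ≤ (x.1 : WithTop ℕ) :=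
        fun h => h1 ((S.col_le_col_succ _ _).trans h)
      rw [hit_of_not_le h1, hit_of_not_le h2] at hs
      rw [hits, hits, hit_of_not_le h1]
      have hpos : 0 ≤ (S.removeBox (c + 1)).slack k x := by
        by_cases h0 : S.col (c + 1) k ≤ (x.1 : WithTop ℕ)
        · have : S.slack k x ≠ 0 := fun h => h1 (col_succ_le hx h0 (singular_iff_slack.2 h))
          rw [hit_of_le h0] at hs
          push_cast at hs
          omega
        · rw [hit_of_not_le h0] at hs
          push_cast at hs
          omega
      have := ih hx' hpos
      push_cast at hs ⊢
      omega

/-- A box that leaves column `w` of `μ⁽ᵏ⁺¹⁾` while none leaves column `w + 1` comes from a row that was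
there from the beginning; so its slack has been used up. -/
lemma exists_slack_le_hits_sub_hits (hk : 1 ≤ k) (w : ℕ) (c : ℕ) :
    ∀ {S : RC}, hits (k + 1) (w + 1) c S = hits (k + 1) w c S + 1 →
      hits (k + 1) (w + 2) c S = hits (k + 1) (w + 1) c S →
      ∃ r, (w + 1, r) ∈ S.rows k ∧
        S.slack k (w + 1, r) ≤ (hits k (w + 1) c S : ℤ) - hits (k + 1) (w + 1) c S := by
  induction c with
  | zero => intro S h; simp [hits] at h
  | succ c ih =>
    intro S h1 h2
    by_cases hw : S.col (c + 1) (k + 1) ≤ ((w + 2 : ℕ) : WithTop ℕ)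
    · obtain ⟨v, hv⟩ := WithTop.ne_top_iff_exists.1 (ne_top_of_le_ne_top (WithTop.coe_ne_top) hw)
      have hvj : v ≤ w + 2 := by rw [← hv] at hw; exact natCast_le_natCast.1 hw
      have hle : ∀ i, v ≤ i → S.col (c + 1) (k + 1) ≤ (i : WithTop ℕ) := by
        intro i hi
        rw [← hv]
        exact natCast_le_natCast.2 hi
      rcases lt_trichotomy v (w + 1) with hlt | rfl | hgt
      · rw [hits_eq_length (c + 1) (fun _ => hle _ (by omega : v ≤ w)),
          hits_eq_length (c + 1) (fun _ => hle _ (by omega : v ≤ w + 1))] at h1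
        omega
      · obtain ⟨hm, hc⟩ := col_succ_spec hv.symm
        refine ⟨_, hm, ?_⟩
        rw [hits_eq_length (c + 1) (fun _ => hc), hits_eq_length (c + 1) (fun _ => hv.symm.le)]
        simp [slack]
      · obtain rfl : v = w + 2 := by omega
        rw [hits_eq_length (c + 1) (fun _ => hw), hits, hits_removeBox hw, hit_of_not_le] at h2
        · omega
        · exact fun h => by
            rw [← hv] at h
            have : w + 2 ≤ w + 1 := natCast_le_natCast.1 h
            omega
    · have hw1 : ¬ S.col (c + 1) (k + 1) ≤ ((w + 1 : ℕ) : WithTop ℕ) :=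
        fun h => hw (h.trans (natCast_le_natCast.2 (by omega)))
      have hw0 : ¬ S.col (c + 1) (k + 1) ≤ (w : WithTop ℕ) :=
        fun h => hw (h.trans (natCast_le_natCast.2 (by omega)))
      simp only [hits, hit_of_not_le hw, hit_of_not_le hw1, hit_of_not_le hw0, zero_add] at h1 h2 ⊢
      obtain ⟨r, hr, hs⟩ := ih h1 h2
      refine ⟨r, ?_, ?_⟩
      · rcases mem_or_of_mem_removeBox hr with h | ⟨h, -⟩
        · exact h
        · exact absurd h.le hw
      · have := S.slack_removeBox (c := c + 1) (by omega) hk (w + 1, r)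
        have h3 : ¬ S.col (c + 1) (k + 2) ≤ ((w + 1 : ℕ) : WithTop ℕ) :=
          fun h => hw1 ((S.col_le_col_succ _ _).trans h)
        simp only [hit_of_not_le hw1, hit_of_not_le h3] at this
        push_cast at this ⊢
        omega

lemma mem_removeRow (hk : 1 ≤ k) (x : ℕ × ℤ) (c : ℕ) :
    ∀ {S : RC}, x ∈ (S.removeRow c).rows k → x ∈ S.rows k ∨
      (hits (k + 1) (x.1 + 1) c S = hits (k + 1) x.1 c S + 1 ∧
      (S.removeRow c).slack k x = (hits (k + 1) x.1 c S : ℤ) - hits (k + 2) x.1 c S) := by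
  induction c with
  | zero => intro S h; exact Or.inl h
  | succ c ih =>
    intro S h
    rcases ih (S := S.removeBox (c + 1)) h with h | ⟨h, hs⟩
    · rcases mem_or_of_mem_removeBox h with h | ⟨h, hsing⟩
      · exact Or.inl h
      · right
        have h1 : ¬ S.col (c + 1) (k + 1) ≤ (x.1 : WithTop ℕ) := by
          rw [h]
          exact fun h => by
            have := natCast_le_natCast.1 h
            omega
        have h2 : ¬ S.col (c + 1) (k + 2) ≤ (x.1 : WithTop ℕ) :=
          fun h => h1 ((S.col_le_col_succ _ _).trans h)
        have h3 := slack_removeRow hk x c (S.removeBox (c + 1))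
        rw [singular_iff_slack.1 hsing, hits_removeBox h.le,
          hits_removeBox ((S.col_le_col_succ _ _).trans h.le)] at h3
        refine ⟨?_, ?_⟩
        · rw [hits_eq_length (c + 1) (fun _ => h.le), hits, hits_removeBox h.le, hit_of_not_le h1,
            zero_add]
        · rw [hits, hits, hit_of_not_le h1, hit_of_not_le h2, hits_removeBox h.le]
          rw [removeRow, h3]
          push_cast
          ring
    · right
      by_cases hw : S.col (c + 1) (k + 1) ≤ ((x.1 + 1 : ℕ) : WithTop ℕ)
      · have := hits_le (k + 1) (x.1 + 1) c (S.removeBox (c + 1))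
        rw [hits_removeBox hw] at h
        omega
      · have hw1 : ¬ S.col (c + 1) (k + 1) ≤ (x.1 : WithTop ℕ) :=
          fun h => hw (h.trans (natCast_le_natCast.2 (by omega)))
        have hw2 : ¬ S.col (c + 1) (k + 2) ≤ (x.1 : WithTop ℕ) :=
          fun h => hw1 ((S.col_le_col_succ _ _).trans h)
        simp only [hits, hit_of_not_le hw, hit_of_not_le hw1, hit_of_not_le hw2, zero_add]
        exact ⟨h, hs⟩

/-- A lower bound for the slack of every row after a row of the quantum space has been removed. -/
lemma hits_sub_hits_le_slack_removeRow (hk : 1 ≤ k) (c : ℕ) {S : RC}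
    (hS : ∀ x ∈ S.rows k, 0 ≤ S.slack k x) (x : ℕ × ℤ) (hx : x ∈ (S.removeRow c).rows k) :
    (hits (k + 1) x.1 c S : ℤ) - hits (k + 2) x.1 c S ≤ (S.removeRow c).slack k x := by
  rcases mem_removeRow hk x c hx with h | ⟨-, h⟩
  · have := hits_sub_hits_le_slack hk x c h (hS x h)
    rw [slack_removeRow hk]
    omega
  · exact h.ge

lemma mem_removeRow_of_hits_eq (w : ℕ) (r : ℤ) (c : ℕ) :
    ∀ {S : RC}, (w + 1, r) ∈ S.rows k → hits (k + 1) (w + 1) c S = hits (k + 1) w c S →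
      (w + 1, r) ∈ (S.removeRow c).rows k := by
  induction c with
  | zero => intro S h _; exact h
  | succ c ih =>
    intro S h h1
    by_cases hw : S.col (c + 1) (k + 1) = ((w + 1 : ℕ) : WithTop ℕ)
    · rw [hits_eq_length (c + 1) (fun _ => hw.le), hits, hits_removeBox hw.le, hit_of_not_le] at h1
      · omega
      · rw [hw]
        exact fun h => by
          have := natCast_le_natCast.1 h
          omega
    · refine ih (mem_removeBox_of_ne h hw) ?_
      have : S.hit (c + 1) (k + 1) (w + 1) = S.hit (c + 1) (k + 1) w := by
        cases hv : S.col (c + 1) (k + 1) with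
        | top => simp [hit, hv]
        | coe v =>
          have hne : v ≠ w + 1 := fun h => hw (by rw [hv, h]; rfl)
          have h2 : (v : WithTop ℕ) ≤ ((w + 1 : ℕ) : WithTop ℕ) ↔ (v : WithTop ℕ) ≤ (w : WithTop ℕ) :=
            natCast_le_natCast.trans ((by omega : v ≤ w + 1 ↔ v ≤ w).trans natCast_le_natCast.symm)
          unfold hit
          rw [hv]
          exact if_congr h2 rfl rfl
      rw [hits, hits, this] at h1
      omega

/-- If a box leaves column `w + 2` of `μ⁽ᵏ⁺¹⁾` and none leaves column `w + 1`, then the row of width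
`w + 1` produced by this attains the bound of `hits_sub_hits_le_slack_removeRow`. -/
lemma exists_slack_removeRow_eq (hk : 1 ≤ k) (w : ℕ) (c : ℕ) :
    ∀ {S : RC}, hits (k + 1) (w + 2) c S = hits (k + 1) (w + 1) c S + 1 →
      hits (k + 1) (w + 1) c S = hits (k + 1) w c S →
      ∃ r, (w + 1, r) ∈ (S.removeRow c).rows k ∧ (S.removeRow c).slack k (w + 1, r) =
        (hits (k + 1) (w + 1) c S : ℤ) - hits (k + 2) (w + 1) c S := by
  induction c with
  | zero => intro S h; simp [hits] at h
  | succ c ih =>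
    intro S h1 h2
    have hw1 : ¬ S.col (c + 1) (k + 1) ≤ ((w + 1 : ℕ) : WithTop ℕ) := by
      intro h
      rw [hits_eq_length (c + 1) (fun _ => h), hits_eq_length (c + 1) (fun _ => h.trans
        (natCast_le_natCast.2 (by omega)))] at h1
      omega
    have hw0 : ¬ S.col (c + 1) (k + 1) ≤ (w : WithTop ℕ) :=
      fun h => hw1 (h.trans (natCast_le_natCast.2 (by omega)))
    have hw2 : ¬ S.col (c + 1) (k + 2) ≤ ((w + 1 : ℕ) : WithTop ℕ) :=
      fun h => hw1 ((S.col_le_col_succ _ _).trans h)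
    simp only [hits, hit_of_not_le hw1, hit_of_not_le hw0, hit_of_not_le hw2, zero_add] at h1 h2 ⊢
    by_cases hw : S.col (c + 1) (k + 1) ≤ ((w + 2 : ℕ) : WithTop ℕ)
    · have hv : S.col (c + 1) (k + 1) = ((w + 2 : ℕ) : WithTop ℕ) := by
        obtain ⟨v, hv⟩ := WithTop.ne_top_iff_exists.1 (ne_top_of_le_ne_top WithTop.coe_ne_top hw)
        rw [← hv] at hw hw1 ⊢
        have h3 := natCast_le_natCast.1 hw
        have h4 : ¬ v ≤ w + 1 := fun h => hw1 (natCast_le_natCast.2 h)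
        exact congrArg _ (by omega : v = w + 2)
      obtain ⟨r, hr, hs⟩ := shortened_mem hv (by omega)
      refine ⟨r, mem_removeRow_of_hits_eq w r c hr h2, ?_⟩
      have h3 := slack_removeRow hk (w + 1, r) c (S.removeBox (c + 1))
      have h4 : (S.removeBox (c + 1)).slack k (w + 1, r) = 0 := singular_iff_slack.1 hs
      rw [h4] at h3
      simp only [hits_removeBox hw, hits_removeBox ((S.col_le_col_succ _ _).trans hw)] at h3 ⊢
      rw [removeRow, h3]
      ring
    · rw [hit_of_not_le hw, zero_add] at h1
      exact ih h1 h2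

end RC

/-! ### Two rows removed one after the other -/

/-- The counting function of a finite set of columns: `f j` is the number of its elements `≤ j`. -/
structure IsCount (f : ℕ → ℕ) : Prop where
  zero : f 0 = 0
  mono : ∀ j, f j ≤ f (j + 1)
  step : ∀ j, f (j + 1) ≤ f j + 1
  eventually : ∃ N, ∀ j, N ≤ j → f j = f N

/-- Two differences `b - a` and `b' - a'` of counting functions are compared: `b' - a'` is bounded by
the upper bounds of `b - a` as soon as it is at most `b - a` wherever a run of jumps of `b'` ends. -/
lemma sub_le_of_forall_sub_le {a a' b b' : ℕ → ℕ} (ha : IsCount a) (ha' : IsCount a')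
    (hb : IsCount b) (hb' : IsCount b')
    (H : ∀ j, b' (j + 1) = b' j + 1 → b' (j + 2) = b' (j + 1) →
      (b' (j + 1) : ℤ) - a' (j + 1) ≤ b (j + 1) - a (j + 1))
    {w : ℤ} (hw : ∀ j, (b j : ℤ) - a j ≤ w) (j : ℕ) : (b' j : ℤ) - a' j ≤ w := by
  have hw0 : 0 ≤ w := by simpa [ha.zero, hb.zero] using hw 0
  obtain ⟨N, hN⟩ := hb'.eventually
  -- Follow the run of jumps of `b'` to its end: `b' - a'` does not decrease on the way.
  have key : ∀ m j, N ≤ j + m → b' (j + 1) = b' j + 1 → (b' (j + 1) : ℤ) - a' (j + 1) ≤ w := by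
    intro m
    induction m with
    | zero =>
      intro j hj h
      have h1 := hN j hj
      have h2 := hN (j + 1) (by omega)
      omega
    | succ m ih =>
      intro j hj h
      have h3 := ha'.step (j + 1)
      have h4 := hb'.step (j + 1)
      have h5 := hb'.mono (j + 1)
      by_cases hs : b' (j + 1 + 1) = b' (j + 1) + 1
      · have := ih (j + 1) (by omega) hs
        omega
      · exact (H j h (show b' (j + 1 + 1) = _ by omega)).trans (hw _)
  induction j with
  | zero => simpa [ha'.zero, hb'.zero] using hw0
  | succ j ih =>
    have h1 := ha'.mono j
    have h2 := hb'.mono j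
    have h3 := hb'.step j
    by_cases h : b' (j + 1) = b' j + 1
    · exact key N j (by omega) h
    · omega

/-- Conversely, the upper bounds of `b' - a'` and of the final value of `b - a` bound `b - a`. -/
lemma sub_le_of_forall_sub_le' {a a' b b' : ℕ → ℕ} (ha : IsCount a) (ha' : IsCount a')
    (hb : IsCount b) (hb' : IsCount b')
    (H : ∀ j, a (j + 2) = a (j + 1) + 1 → a (j + 1) = a j →
      (b (j + 1) : ℤ) - a (j + 1) ≤ b' (j + 1) - a' (j + 1))
    {w : ℤ} (hw : ∀ j, (b' j : ℤ) - a' j ≤ w) {N : ℕ} (hN : ∀ j, N ≤ j → (b j : ℤ) - a j ≤ w)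
    (j : ℕ) : (b j : ℤ) - a j ≤ w := by
  have hw0 : 0 ≤ w := by simpa [ha'.zero, hb'.zero] using hw 0
  -- Follow a run of jumps of `a` to its beginning: `b - a` does not decrease on the way.
  have key : ∀ j, a (j + 1) = a j + 1 → (b j : ℤ) - a j ≤ w := by
    intro j
    induction j with
    | zero => intro; simpa [ha.zero, hb.zero] using hw0
    | succ j ih =>
      intro h
      have h3 := hb.step j
      have h4 := ha.step j
      have h5 := ha.mono j
      by_cases hs : a (j + 1) = a j + 1
      · have := ih hs
        omega
      · exact (H j h (by omega)).trans (hw _)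
  have down : ∀ m j, N ≤ j + m → (b j : ℤ) - a j ≤ w := by
    intro m
    induction m with
    | zero => exact fun j hj => hN j hj
    | succ m ih =>
      intro j hj
      have h1 := ih (j + 1) (by omega)
      have h2 := hb.mono j
      have h3 := ha.step j
      have h4 := ha.mono j
      by_cases h : a (j + 1) = a j + 1
      · exact key j h
      · omega
  exact down N j (by omega)

namespace RC

lemma isCount_hits (k c : ℕ) (S : RC) : IsCount fun j => hits k j c S where
  zero := hits_zero k c S
  mono j := hits_mono k c S (Nat.le_succ j)
  step j := hits_add_one_le k j c S
  eventually := by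
    obtain ⟨N, hN⟩ := exists_hits_eq_total k c S
    exact ⟨N, fun j hj => by rw [hN j hj, hN N le_rfl]⟩

variable {S T : RC} {k l m : ℕ}

/-- The excess, in the columns `≤ j`, of the boxes which leave `μ⁽ᵏ⁾` when a row of width `m` is removed
from the quantum space of `T` over those which leave `μ⁽ᵏ⁺¹⁾` when a row of width `l` is removed from
the quantum space of `S`. -/
def excess (S T : RC) (l m k j : ℕ) : ℤ := (hits k j m T : ℤ) - hits (k + 1) j l S

/-- The excess in all columns. -/
def totalExcess (S T : RC) (l m k : ℕ) : ℤ := (total k m T : ℤ) - total (k + 1) l S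

lemma exists_excess_eq (S T : RC) (l m k : ℕ) :
    ∃ N, ∀ j, N ≤ j → excess S T l m k j = totalExcess S T l m k := by
  obtain ⟨N, hN⟩ := exists_hits_eq_total k m T
  obtain ⟨N', hN'⟩ := exists_hits_eq_total (k + 1) l S
  exact ⟨max N N', fun j hj => by
    rw [excess, totalExcess, hN j (by omega), hN' j (by omega)]⟩

lemma slack_congr (h : T.rows = S.rows) (hk : 1 ≤ k) (x : ℕ × ℤ) : T.slack k x = S.slack k x := by
  obtain ⟨k, rfl⟩ : ∃ i, k = i + 1 := ⟨k - 1, by omega⟩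
  simp [slack, vacancy, shape, h]

/-- Upper bounds of the excess are passed on to the next diagram. -/
lemma excess_succ_le (hS : ∀ x ∈ S.rows k, 0 ≤ S.slack k x)
    (hT : T.rows = (S.removeRow l).rows) (hk : 1 ≤ k) {w : ℤ}
    (hw : ∀ j, excess S T l m k j ≤ w) (j : ℕ) : excess S T l m (k + 1) j ≤ w := by
  refine sub_le_of_forall_sub_le (isCount_hits (k + 1) l S) (isCount_hits (k + 2) l S)
    (isCount_hits k m T) (isCount_hits (k + 1) m T) (fun i h1 h2 => ?_) hw j
  obtain ⟨r, hr, hle⟩ := exists_slack_le_hits_sub_hits hk i m h1 h2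
  rw [hT] at hr
  rw [slack_congr hT hk] at hle
  have := hits_sub_hits_le_slack_removeRow hk l hS _ hr
  simp only at this ⊢
  omega

/-- Upper bounds of the excess in `μ⁽ᵏ⁺¹⁾` and of the total excess in `μ⁽ᵏ⁾` bound the excess in
`μ⁽ᵏ⁾`. -/
lemma excess_le_of_succ (hS : ∀ x ∈ S.rows k, 0 ≤ S.slack k x)
    (hT : T.rows = (S.removeRow l).rows) (hk : 1 ≤ k) {w : ℤ}
    (hw : ∀ j, excess S T l m (k + 1) j ≤ w) (htot : totalExcess S T l m k ≤ w) (j : ℕ) :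
    excess S T l m k j ≤ w := by
  obtain ⟨N, hN⟩ := exists_excess_eq S T l m k
  refine sub_le_of_forall_sub_le' (isCount_hits (k + 1) l S) (isCount_hits (k + 2) l S)
    (isCount_hits k m T) (isCount_hits (k + 1) m T) (fun i h1 h2 => ?_) hw
    (fun j hj => (hN j hj).trans_le htot) j
  obtain ⟨r, hr, heq⟩ := exists_slack_removeRow_eq hk i l h1 h2
  have h0 := hits_sub_hits_le_slack_removeRow hk l hS _ hr
  have h3 : hits (k + 2) (i + 1) l S ≤ hits (k + 1) (i + 1) l S := hits_succ_le _ _ _ _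
  rw [← slack_congr hT hk] at heq h0
  rw [← hT] at hr
  have := hits_sub_hits_le_slack hk _ m hr (by simp only at h0 ⊢; omega)
  simp only at this ⊢
  omega

/-- The maximum over `j` of the excess in `μ⁽¹⁾` is the maximum of the total excesses. -/
lemma excess_max (hS : ∀ k, 1 ≤ k → ∀ x ∈ S.rows k, 0 ≤ S.slack k x)
    (hT : T.rows = (S.removeRow l).rows) {w : ℤ} (hw : ∀ j, excess S T l m 1 j ≤ w)
    (hmax : ∃ j, excess S T l m 1 j = w) {K : ℕ} (hK : ∀ k, K ≤ k → ∀ j, excess S T l m k j = 0) :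
    (∀ k, 1 ≤ k → totalExcess S T l m k ≤ w) ∧ ∃ k, 1 ≤ k ∧ totalExcess S T l m k = w := by
  have hle : ∀ k, 1 ≤ k → ∀ j, excess S T l m k j ≤ w := by
    intro k hk
    induction k, hk using Nat.le_induction with
    | base => exact hw
    | succ k hk ih => exact excess_succ_le (hS k hk) hT hk ih
  have hle' : ∀ k, 1 ≤ k → totalExcess S T l m k ≤ w := by
    intro k hk
    obtain ⟨N, hN⟩ := exists_excess_eq S T l m k
    rw [← hN N le_rfl]
    exact hle k hk N
  refine ⟨hle', ?_⟩
  by_contra! hne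
  have hlt : ∀ k, 1 ≤ k → totalExcess S T l m k ≤ w - 1 := fun k hk => by
    have := hle' k hk
    have := hne k hk
    omega
  have hw1 : 0 ≤ w - 1 := by
    obtain ⟨N, hN⟩ := exists_excess_eq S T l m (K + 1)
    have := hlt (K + 1) (by omega)
    rwa [← hN N le_rfl, hK (K + 1) (by omega)] at this
  have down : ∀ i k, 1 ≤ k → K ≤ k + i → ∀ j, excess S T l m k j ≤ w - 1 := by
    intro i
    induction i with
    | zero =>
      intro k _ hk j
      rw [hK k hk]
      exact hw1
    | succ i ih =>
      intro k hk hi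
      exact excess_le_of_succ (hS k hk) hT hk (ih (k + 1) (by omega) (by omega)) (hlt k hk)
  obtain ⟨j, hj⟩ := hmax
  have := down K 1 le_rfl (by omega) j
  omega

end RC

/-! ### Winding and unwinding numbers as covering numbers -/

/-- The size of a vertex cover of the graph that joins the letters of `x` to all larger letters of `y`,
which consists of the letters of `x` below the threshold `t` and the letters of `y` above it. -/
def cover (x y : List ℕ) (t : ℕ) : ℕ := x.countP (· < t) + y.countP (t < ·)

/-- `u` is the smallest size of a threshold cover. -/
def IsMinCover (x y : List ℕ) (u : ℕ) : Prop := (∀ t, u ≤ cover x y t) ∧ ∃ t, cover x y t = u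

lemma IsMinCover.unique {x y : List ℕ} {u v : ℕ} (hu : IsMinCover x y u) (hv : IsMinCover x y v) :
    u = v := by
  obtain ⟨hu, s, hs⟩ := hu
  obtain ⟨hv, t, ht⟩ := hv
  have := hu t
  have := hv s
  omega

lemma countP_eq_erase_add {l : List ℕ} {c : ℕ} (hc : c ∈ l) (p : ℕ → Bool) :
    l.countP p = (l.erase c).countP p + if p c then 1 else 0 := by
  rw [(List.perm_cons_erase hc).countP_eq, List.countP_cons]

/-- The effect of deleting a letter `c` of `x` and a letter `b` of `y` that are connected. -/
lemma cover_cons {x : List ℕ} {c : ℕ} (hc : c ∈ x) (b : ℕ) (y : List ℕ) (t : ℕ) :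
    cover x (b :: y) t = cover (x.erase c) y t + (if c < t then 1 else 0) +
      if t < b then 1 else 0 := by
  simp only [cover, List.countP_cons, countP_eq_erase_add hc (· < t), decide_eq_true_eq]
  omega

lemma cover_cons' {y : List ℕ} {c : ℕ} (hc : c ∈ y) (b : ℕ) (x : List ℕ) (t : ℕ) :
    cover (b :: x) y t = cover x (y.erase c) t + (if b < t then 1 else 0) +
      if t < c then 1 else 0 := by
  simp only [cover, List.countP_cons, countP_eq_erase_add hc (t < ·), decide_eq_true_eq]
  omega

lemma countP_lt_mono (x : List ℕ) {s t : ℕ} (h : s ≤ t) :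
    x.countP (· < s) ≤ x.countP (· < t) :=
  List.countP_mono_left fun a _ ha => by simp at ha ⊢; omega

lemma countP_gt_anti (x : List ℕ) {s t : ℕ} (h : s ≤ t) :
    x.countP (t < ·) ≤ x.countP (s < ·) :=
  List.countP_mono_left fun a _ ha => by simp at ha ⊢; omega

lemma pairRight_spec (y : List ℕ) : ∀ x : List ℕ, y.length ≤ x.length →
    IsMinCover x y (pairRight x y).2 ∧ (pairRight x y).1 + (pairRight x y).2 = y.length := by
  induction y with
  | nil => exact fun x _ => ⟨⟨by simp [pairRight], 0, by simp [pairRight, cover]⟩, by simp [pairRight]⟩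
  | cons b y ih =>
    intro x hlen
    rw [List.length_cons] at hlen
    cases h : (x.filter (· < b)).max? with
    | some c =>
      obtain ⟨hmem, hmax⟩ := List.max?_eq_some_iff.1 h
      obtain ⟨hc, hcb⟩ : c ∈ x ∧ c < b := by simpa using hmem
      have hl := List.length_erase_of_mem hc
      obtain ⟨⟨hle, t, ht⟩, hsum⟩ := ih (x.erase c) (by omega)
      simp only [pairRight, h]
      refine ⟨⟨fun s => ?_, ?_⟩, by simp only [List.length_cons]; omega⟩
      · have := hle s
        rw [cover_cons hc]
        split_ifs <;> omega
      · by_cases hct : c < t ∧ t < b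
        · -- No letter of `x` lies strictly between `c` and `b`, so `t` may be replaced by `b`.
          refine ⟨b, ?_⟩
          have h1 : (x.erase c).countP (· < b) ≤ (x.erase c).countP (· < t) :=
            List.countP_mono_left fun a ha hab => by
              have := hmax a (by simpa using ⟨List.mem_of_mem_erase ha, by simpa using hab⟩)
              simp; omega
          have h2 := countP_gt_anti y hct.2.le
          have := hle b
          rw [cover_cons hc]
          simp only [cover] at *
          split_ifs <;> omega
        · refine ⟨t, ?_⟩
          rw [cover_cons hc]
          split_ifs <;> omega
    | none =>
      have hno : ∀ a ∈ x, b ≤ a := by simpa [List.max?_eq_none_iff] using h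
      cases h' : x.max? with
      | none =>
        rw [List.max?_eq_none_iff] at h'
        subst h'
        simp at hlen
      | some c =>
        obtain ⟨hc, hmax⟩ := List.max?_eq_some_iff.1 h'
        have hbc := hno c hc
        have hl := List.length_erase_of_mem hc
        obtain ⟨⟨hle, t, ht⟩, hsum⟩ := ih (x.erase c) (by omega)
        simp only [pairRight, h, h']
        refine ⟨⟨fun s => ?_, ?_⟩, by simp only [List.length_cons]; omega⟩
        · have := hle s
          rw [cover_cons hc]
          split_ifs <;> omega
        · have h0 : (x.erase c).countP (· < b) = 0 := by
            rw [List.countP_eq_zero]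
            intro a ha
            have := hno a (List.mem_of_mem_erase ha)
            simp; omega
          by_cases htc : b ≤ t ∧ t ≤ c
          · refine ⟨t, ?_⟩
            rw [cover_cons hc]
            split_ifs <;> omega
          · -- The threshold `b` is optimal, too.
            refine ⟨b, ?_⟩
            have := hle b
            rw [cover_cons hc]
            simp only [cover] at *
            have h2 : y.countP (b < ·) ≤ y.length := List.countP_le_length
            by_cases htb : t < b
            · have := countP_gt_anti y htb.le
              split_ifs <;> omega
            · have : (x.erase c).countP (· < t) = (x.erase c).length := by
                rw [List.countP_eq_length]
                intro a ha
                have := hmax a (List.mem_of_mem_erase ha)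
                simp; omega
              split_ifs <;> omega

lemma pairLeft_spec (x : List ℕ) : ∀ y : List ℕ, x.length ≤ y.length →
    IsMinCover x y (pairLeft y x).2 ∧ (pairLeft y x).1 + (pairLeft y x).2 = x.length := by
  induction x with
  | nil =>
    refine fun y _ => ⟨⟨by simp [pairLeft], y.sum, ?_⟩, by simp [pairLeft]⟩
    simp only [cover, pairLeft, List.countP_nil, zero_add, List.countP_eq_zero]
    intro a ha
    have := List.le_sum_of_mem ha
    simp; omega
  | cons b x ih =>
    intro y hlen
    rw [List.length_cons] at hlen
    cases h : (y.filter (b < ·)).min? with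
    | some c =>
      obtain ⟨hmem, hmin⟩ := List.min?_eq_some_iff.1 h
      obtain ⟨hc, hcb⟩ : c ∈ y ∧ b < c := by simpa using hmem
      have hl := List.length_erase_of_mem hc
      obtain ⟨⟨hle, t, ht⟩, hsum⟩ := ih (y.erase c) (by omega)
      simp only [pairLeft, h]
      refine ⟨⟨fun s => ?_, ?_⟩, by simp only [List.length_cons]; omega⟩
      · have := hle s
        rw [cover_cons' hc]
        split_ifs <;> omega
      · by_cases hct : b < t ∧ t < c
        · -- No letter of `y` lies strictly between `b` and `c`, so `t` may be replaced by `b`.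
          refine ⟨b, ?_⟩
          have h1 : (y.erase c).countP (b < ·) ≤ (y.erase c).countP (t < ·) :=
            List.countP_mono_left fun a ha hab => by
              have := hmin a (by simpa using ⟨List.mem_of_mem_erase ha, by simpa using hab⟩)
              simp; omega
          have h2 := countP_lt_mono x hct.1.le
          have := hle b
          rw [cover_cons' hc]
          simp only [cover] at *
          split_ifs <;> omega
        · refine ⟨t, ?_⟩
          rw [cover_cons' hc]
          split_ifs <;> omega
    | none =>
      have hno : ∀ a ∈ y, a ≤ b := by simpa [List.min?_eq_none_iff] using h
      cases h' : y.min? with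
      | none =>
        rw [List.min?_eq_none_iff] at h'
        subst h'
        simp at hlen
      | some c =>
        obtain ⟨hc, hmin⟩ := List.min?_eq_some_iff.1 h'
        have hbc := hno c hc
        have hl := List.length_erase_of_mem hc
        obtain ⟨⟨hle, t, ht⟩, hsum⟩ := ih (y.erase c) (by omega)
        simp only [pairLeft, h, h']
        refine ⟨⟨fun s => ?_, ?_⟩, by simp only [List.length_cons]; omega⟩
        · have := hle s
          rw [cover_cons' hc]
          split_ifs <;> omega
        · have h0 : (y.erase c).countP (b < ·) = 0 := by
            rw [List.countP_eq_zero]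
            intro a ha
            have := hno a (List.mem_of_mem_erase ha)
            simp; omega
          by_cases htc : c ≤ t ∧ t ≤ b
          · refine ⟨t, ?_⟩
            rw [cover_cons' hc]
            split_ifs <;> omega
          · -- The threshold `b` is optimal, too.
            refine ⟨b, ?_⟩
            have := hle b
            rw [cover_cons' hc]
            simp only [cover] at *
            have h2 : x.countP (· < b) ≤ x.length := List.countP_le_length
            by_cases htb : b < t
            · have := countP_lt_mono x htb.le
              split_ifs <;> omega
            · have : (y.erase c).countP (t < ·) = (y.erase c).length := by
                rw [List.countP_eq_length]
                intro a ha
                have := hmin a (List.mem_of_mem_erase ha)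
                simp; omega
              split_ifs <;> omega

lemma isMinCover_unwindingNumber (x y : List ℕ) : IsMinCover x y (unwindingNumber x y) := by
  unfold unwindingNumber pairs
  split_ifs with h
  · exact (pairRight_spec y x h).1
  · exact (pairLeft_spec x y (by omega)).1

lemma energy_add_unwindingNumber (x y : List ℕ) :
    energy x y + unwindingNumber x y = min x.length y.length := by
  unfold energy unwindingNumber pairs
  split_ifs with h
  · rw [(pairRight_spec y x h).2]; omega
  · rw [(pairLeft_spec x y (by omega)).2]; omega

namespace RC

variable {S T : RC} {c k j w : ℕ} {x : ℕ × ℤ}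

/-! ### The letters of a tableau -/

lemma length_tableau (a k c : ℕ) (S : RC) : (S.tableau a k c).length = c := by
  induction c generalizing S with
  | zero => rfl
  | succ c ih => simp [tableau, ih]

lemma total_zero (c : ℕ) (S : RC) : total 0 c S = c := by
  induction c generalizing S with
  | zero => rfl
  | succ c ih =>
    have : S.col (c + 1) 0 ≠ ⊤ := WithTop.coe_ne_top
    rw [total, ih, if_pos this, add_comm]

lemma le_letter (a k c : ℕ) (S : RC) : a ≤ S.letter a k c := Nat.le_add_right _ _

lemma lt_letter_iff {a i : ℕ} (hS : ∀ i, k < i → S.col c i = ⊤) :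
    a + i < S.letter a k c ↔ S.col c (i + 1) ≠ ⊤ := by
  unfold letter
  rw [Nat.add_lt_add_iff_left]
  constructor
  · intro h htop
    have h1 := Nat.findGreatest_spec (P := fun i => S.col c i ≠ ⊤) (n := k) (m := 0)
      (Nat.zero_le k) WithTop.coe_ne_top
    have h2 := S.col_mono c (Nat.succ_le_of_lt h)
    rw [Nat.succ_eq_add_one, htop] at h2
    exact h1 (top_le_iff.1 h2)
  · intro h
    refine Nat.le_findGreatest ?_ h
    by_contra hk
    exact h (hS _ (by omega))

lemma col_eq_top_of_rows_eq_zero (h : S.rows k = 0) : S.col c (k + 1) = ⊤ := by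
  cases hw : S.col c (k + 1) with
  | top => rfl
  | coe w =>
    have := (col_succ_spec hw).1
    simp [h] at this

lemma rows_removeBox_eq_zero (h : S.rows k = 0) : (S.removeBox c).rows k = 0 := by
  rw [rows_removeBox_top (col_eq_top_of_rows_eq_zero h), h]

lemma countP_letters_gt {a i : ℕ} (c : ℕ) : ∀ {S : RC}, (∀ i, k ≤ i → S.rows i = 0) →
    (S.tableau a k c).countP (a + i < ·) = total (i + 1) c S := by
  induction c with
  | zero => intros; rfl
  | succ c ih =>
    intro S hS
    have h : a + i < S.letter a k (c + 1) ↔ S.col (c + 1) (i + 1) ≠ ⊤ := by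
      refine lt_letter_iff fun i hi => ?_
      obtain ⟨i, rfl⟩ : ∃ m, i = m + 1 := ⟨i - 1, by omega⟩
      exact col_eq_top_of_rows_eq_zero (hS i (by omega))
    rw [tableau, List.countP_cons, ih fun i hi => rows_removeBox_eq_zero (hS i hi), total,
      add_comm]
    simp only [decide_eq_true_eq, h]

lemma le_of_mem_tableau {a v : ℕ} (c : ℕ) : ∀ {S : RC}, v ∈ S.tableau a k c → a ≤ v := by
  induction c with
  | zero => simp [tableau]
  | succ c ih =>
    intro S h
    rcases List.mem_cons.1 h with rfl | h
    · exact le_letter _ _ _ _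
    · exact ih h

lemma countP_letters_lt_add_total {a i : ℕ} (c : ℕ) {S : RC} (hS : ∀ i, k ≤ i → S.rows i = 0) :
    (S.tableau a k c).countP (· < a + i) + total i c S = c := by
  cases i with
  | zero =>
    rw [total_zero, List.countP_eq_zero.2, zero_add]
    intro v hv
    have := le_of_mem_tableau c hv
    simpa using this
  | succ i =>
    rw [← countP_letters_gt (a := a) (i := i) c hS]
    conv_rhs => rw [← length_tableau a k c S]
    rw [List.length_eq_countP_add_countP (fun v => decide (v < a + (i + 1)))]
    congr 1
    refine List.countP_congr fun v _ => ?_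
    simp
    omega

/-- The threshold covers for two successive tableaux, in terms of the total excesses. -/
lemma cover_tableau {a i l m : ℕ} (hS : ∀ i, k ≤ i → S.rows i = 0)
    (hT : ∀ i, k ≤ i → T.rows i = 0) :
    (cover (T.tableau a k m) (S.tableau a k l) (a + i) : ℤ) = m - totalExcess S T l m i := by
  have h1 := countP_letters_lt_add_total (a := a) (i := i) m hT
  have h2 := countP_letters_gt (a := a) (i := i) l hS
  rw [cover, totalExcess, h2]
  push_cast
  omega

/-! ### Removal of a singular row of `μ⁽¹⁾` -/

lemma col_one_of_singular (hx : x ∈ S.rows 0) (hs : S.Singular 0 x) :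
    S.col x.1 1 = (x.1 : WithTop ℕ) :=
  le_antisymm (col_succ_le hx le_rfl hs) (S.le_col _ _)

lemma singular_step {r : ℤ} (hx : (c + 1, r) ∈ S.rows 0) (hs : S.Singular 0 (c + 1, r)) (hc : 1 ≤ c) :
    ∃ r', (c, r') ∈ (S.removeBox (c + 1)).rows 0 ∧ (S.removeBox (c + 1)).Singular 0 (c, r') :=
  shortened_mem (col_one_of_singular hx hs) (by omega)

lemma hits_one_of_singular (j c : ℕ) : ∀ {S : RC} {r : ℤ},
    (1 ≤ c → (c, r) ∈ S.rows 0 ∧ S.Singular 0 (c, r)) → hits 1 j c S = min c j := by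
  induction c with
  | zero => intros; simp [hits]
  | succ c ih =>
    intro S r h
    obtain ⟨hx, hs⟩ := h (by omega)
    have hcol := col_one_of_singular hx hs
    have hh : S.hit (c + 1) 1 j = if c + 1 ≤ j then 1 else 0 := by
      unfold hit
      rw [hcol]
      exact if_congr natCast_le_natCast rfl rfl
    have : hits 1 j c (S.removeBox (c + 1)) = min c j := by
      rcases Nat.eq_zero_or_pos c with rfl | hc
      · simp [hits]
      · obtain ⟨r', h1, h2⟩ := singular_step hx hs hc
        exact ih (r := r') fun _ => ⟨h1, h2⟩
    rw [hits, this, hh]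
    split_ifs <;> omega

lemma rows_removeRow_of_singular (c : ℕ) : ∀ {S : RC} {r : ℤ} {ν : Multiset (ℕ × ℤ)},
    S.rows 0 = (if c = 0 then 0 else {(c, r)}) + ν → (1 ≤ c → S.Singular 0 (c, r)) →
    (S.removeRow c).rows 0 = ν := by
  induction c with
  | zero => intro S r ν h _; simpa [removeRow] using h
  | succ c ih =>
    intro S r ν h hs
    have hs := hs (by omega)
    have hx : (c + 1, r) ∈ S.rows 0 := by simp [h]
    have hrows := rows_removeBox_coe (col_one_of_singular hx hs)
    have hr : r = vacancy S.shape 0 (c + 1) := hs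
    refine ih (r := vacancy (S.shapeAfter (c + 1)) 0 c) (S := S.removeBox (c + 1)) ?_ ?_
    · rw [hrows, h, ← hr, if_neg (by omega), Multiset.singleton_add, Multiset.erase_cons_head]
      rcases Nat.eq_zero_or_pos c with rfl | hc
      · simp
      · simp [hc.ne', add_comm]
    · intro _
      simp [Singular, shape_removeBox]

lemma quantum_removeRow (c : ℕ) : ∀ {S : RC} {q : Multiset ℕ},
    S.quantum = (if c = 0 then 0 else {c}) + q → (S.removeRow c).quantum = q := by
  induction c with
  | zero => intro S q h; simpa [removeRow] using h
  | succ c ih =>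
    intro S q h
    refine ih (S := S.removeBox (c + 1)) ?_
    change S.quantum.erase (c + 1) + (if c + 1 ≤ 1 then 0 else {c}) = _
    rw [h, if_neg (by omega), Multiset.singleton_add, Multiset.erase_cons_head]
    rcases Nat.eq_zero_or_pos c with rfl | hc
    · simp
    · simp [hc.ne', add_comm]

/-! ### Rows of the quantum space that are removed quietly -/

lemma col_one_of_noneSingular (h : S.NoneSingular) : S.col c 1 = ⊤ := by
  cases hw : S.col c 1 with
  | top => rfl
  | coe w => exact absurd rfl (h _ (col_succ_spec hw).1)

lemma rows_removeBox_of_noneSingular (h : S.NoneSingular) : (S.removeBox c).rows = S.rows := by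
  funext k
  refine rows_removeBox_top (top_le_iff.1 ?_)
  exact (col_one_of_noneSingular h).ge.trans (S.col_mono c (by omega))

lemma rows_removeRow_of_quiet (c : ℕ) : ∀ {S : RC}, QuietRow c S →
    (S.removeRow c).rows = S.rows := by
  induction c with
  | zero => intros; rfl
  | succ c ih =>
    intro S h
    rw [removeRow, ih h.2, rows_removeBox_of_noneSingular h.1]

lemma rows_removeRows_of_quiet (cs : List ℕ) : ∀ {S : RC}, QuietRows cs S →
    (S.removeRows cs).rows = S.rows := by
  induction cs with
  | nil => intros; rfl
  | cons c cs ih =>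
    intro S h
    rw [removeRows, ih h.2, rows_removeRow_of_quiet c h.1]

lemma quantum_removeRows (cs : List ℕ) : ∀ {S : RC} {q : Multiset ℕ}, (∀ c ∈ cs, 1 ≤ c) →
    S.quantum = (cs : Multiset ℕ) + q → (S.removeRows cs).quantum = q := by
  induction cs with
  | nil => intro S q _ h; simpa [removeRows] using h
  | cons c cs ih =>
    intro S q hpos h
    refine ih (fun c hc => hpos c (List.mem_cons_of_mem _ hc)) (quantum_removeRow c ?_)
    have := hpos c List.mem_cons_self
    rw [h, if_neg (by omega), ← Multiset.cons_coe, Multiset.cons_add, Multiset.singleton_add]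

lemma quantum_removeRows_ones {d e : ℕ} (h : e ≤ d) {q : Multiset ℕ}
    (hq : S.quantum = q + Multiset.replicate d 1) :
    (S.removeRows (List.replicate (d - e) 1)).quantum = q + Multiset.replicate e 1 := by
  refine quantum_removeRows _ (fun c hc => (List.eq_of_mem_replicate hc).ge) ?_
  rw [hq, Multiset.coe_replicate, add_left_comm, ← Multiset.replicate_add]
  congr 3
  omega

end RC

/-! ### The first two factors -/

lemma boxes_add (μ ν : Multiset ℕ) (j : ℕ) : boxes (μ + ν) j = boxes μ j + boxes ν j := by
  simp [boxes]

lemma boxes_replicate_one (d : ℕ) {j : ℕ} (hj : 1 ≤ j) : boxes (Multiset.replicate d 1) j = d := by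
  simp [boxes, hj]

open RC in
/-- Two rows `x` and `y` are removed one after the other, each when it is singular. The number of boxes
that leave the columns of `μ⁽²⁾` up to the width of `y` together with `x` is the unwinding number. -/
lemma hits_two_eq_unwindingNumber {S T : RC} {x y : ℕ × ℤ} (a k : ℕ)
    (hS0 : ∀ i, k ≤ i → S.rows i = 0)
    (hS : ∀ i, 1 ≤ i → ∀ x ∈ S.rows i, 0 ≤ S.slack i x)
    (hx : x ∈ S.rows 0) (hxs : S.Singular 0 x)
    (hT : T.rows = (S.removeRow x.1).rows)
    (hy : y ∈ T.rows 0) (hys : T.Singular 0 y) :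
    hits 2 y.1 x.1 S = unwindingNumber (T.tableau a k y.1) (S.tableau a k x.1) := by
  have hremove : ∀ i, k ≤ i → T.rows i = 0 := by
    intro i hi
    have h : ∀ (c : ℕ) (U : RC), U.rows i = 0 → (U.removeRow c).rows i = 0 := by
      intro c
      induction c with
      | zero => exact fun _ h => h
      | succ c ih => exact fun U h => ih _ (rows_removeBox_eq_zero h)
    rw [hT]
    exact h _ _ (hS0 i hi)
  have htop : ∀ (U : RC), (∀ i, k ≤ i → U.rows i = 0) → ∀ i, k + 1 ≤ i → ∀ j c,
      hits i j c U = 0 := by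
    intro U hU i hi j c
    induction c generalizing U with
    | zero => rfl
    | succ c ih =>
      obtain ⟨i, rfl⟩ : ∃ m, i = m + 1 := ⟨i - 1, by omega⟩
      rw [hits, ih _ fun i hi => rows_removeBox_eq_zero (hU i hi), hit_of_not_le]
      rw [col_eq_top_of_rows_eq_zero (hU i (by omega))]
      exact fun h => absurd (top_le_iff.1 h) (WithTop.coe_ne_top)
  -- In `μ⁽¹⁾` the row of width `y.1` itself leaves, so the excess grows up to column `y.1` and then
  -- does not grow any more.
  have hexc : ∀ j, excess S T x.1 y.1 1 j = (min y.1 j : ℕ) - (hits 2 j x.1 S : ℤ) := by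
    intro j
    rw [excess, hits_one_of_singular j y.1 (r := y.2) fun _ => ⟨hy, hys⟩]
  have hmax : ∀ j, excess S T x.1 y.1 1 j ≤ y.1 - (hits 2 y.1 x.1 S : ℤ) := by
    intro j
    rw [hexc]
    rcases le_total j y.1 with h | h
    · have : ∀ d, hits 2 (j + d) x.1 S ≤ hits 2 j x.1 S + d := by
        intro d
        induction d with
        | zero => simp
        | succ d ih =>
          have := hits_add_one_le 2 (j + d) x.1 S
          rw [← add_assoc j d 1]
          omega
      have := this (y.1 - j)
      rw [Nat.add_sub_cancel' h] at this
      omega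
    · have := hits_mono 2 x.1 S h
      omega
  obtain ⟨hle, i, -, hi⟩ := excess_max (l := x.1) (m := y.1) hS hT hmax
    ⟨y.1, by rw [hexc, min_self]⟩ (K := k + 1)
    (fun i hi j => by simp [excess, htop T hremove i hi, htop S hS0 (i + 1) (by omega)])
  refine IsMinCover.unique ⟨fun t => ?_, a + i, ?_⟩ (isMinCover_unwindingNumber _ _)
  · have hmono : ∀ i, hits 2 y.1 x.1 S ≤
        cover (T.tableau a k y.1) (S.tableau a k x.1) (a + i) := by
      intro i
      have h := cover_tableau (a := a) (i := i) (l := x.1) (m := y.1) hS0 hremove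
      rcases Nat.eq_zero_or_pos i with rfl | hi
      · have h1 := hits_le 2 y.1 x.1 S
        have h2 : total 1 x.1 S = x.1 := by
          obtain ⟨N, hN⟩ := exists_hits_eq_total 1 x.1 S
          rw [← hN _ (le_max_left N x.1), hits_one_of_singular _ x.1 (r := x.2) fun _ => ⟨hx, hxs⟩]
          exact min_eq_left (le_max_right _ _)
        rw [totalExcess, total_zero, zero_add, h2] at h
        omega
      · have := hle i hi
        omega
    rcases le_total a t with h | h
    · obtain ⟨i, rfl⟩ := Nat.exists_eq_add_of_le h
      exact hmono i
    · -- All letters are at least `a`, so thresholds below `a` are no better than `a`.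
      refine (hmono 0).trans ?_
      have h1 := countP_gt_anti (S.tableau a k x.1) h
      have h2 : (T.tableau a k y.1).countP (· < a) = 0 := by
        rw [List.countP_eq_zero]
        intro v hv
        simpa using le_of_mem_tableau _ hv
      rw [add_zero, cover, cover, h2]
      omega
  · have h := cover_tableau (a := a) (i := i) (l := x.1) (m := y.1) hS0 hremove
    omega

open RC in
/-- The vacancy numbers of `μ⁽¹⁾`, when the quantum space is `μ⁽¹⁾ ∪ (1ᵈ)`. -/
lemma vacancy_zero_eq {S : RC} {d j : ℕ} (hq : S.quantum = S.shape 1 + Multiset.replicate d 1)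
    (hj : 1 ≤ j) : vacancy S.shape 0 j = d - (S.Q 1 j : ℤ) + S.Q 2 j := by
  have : boxes (S.shape 0) j = boxes (S.shape 1) j + d := by
    rw [show S.shape 0 = S.quantum from rfl, hq, boxes_add, boxes_replicate_one d hj]
  simp only [vacancy, this, Q]
  push_cast
  ring

end KKR

open KKR KKR.RC in
theorem theorem5p1 (n a : ℕ) (ha : 1 ≤ a) (han : a < n) (R : KKR.RC) (hR : R.IsRigged n)
    (A B : KKR.Factor) (rest : List KKR.Factor)
    (h : KKR.IsNormalOrdered n a R (A :: B :: rest)) :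
    A.deltaQ 2 B.tableau.length = (KKR.unwindingNumber B.tableau A.tableau : ℤ) ∧
    (KKR.Collision A.before A.row B.row →
      (A.mode : ℤ) - (B.mode : ℤ) = (KKR.energy B.tableau A.tableau : ℤ)) := by
  obtain ⟨L, cs, hcs, hquiet, hrem⟩ := h
  set P := (R.truncate (a - 1)).plus L with hP
  cases hrem with
  | @cons _ S _ d x _ hd hquiet₁ hS hx hxs hrem =>
  cases hrem with
  | @cons _ T _ e y _ he hquiet₂ hT hy hys hrem =>
  have hSrows : S.rows = fun i => R.rows (a - 1 + i) := by
    rw [hS, rows_removeRows_of_quiet _ hquiet₁, rows_removeRows_of_quiet _ hquiet]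
    rfl
  have hTrows : T.rows = (S.removeRow x.1).rows := by
    rw [hT, rows_removeRows_of_quiet _ hquiet₂]
  have hshape : ∀ i, S.shape (i + 1) = R.shape (a - 1 + (i + 1)) := by
    intro i
    change (S.rows i).map Prod.fst = (R.rows (a - 1 + i)).map Prod.fst
    rw [hSrows]
  have hS0 : ∀ i, n - a ≤ i → S.rows i = 0 := by
    intro i hi
    rw [hSrows]
    exact hR.rows_eq_zero _ (by omega)
  have hslack : ∀ i, 1 ≤ i → ∀ z ∈ S.rows i, 0 ≤ S.slack i z := by
    intro i hi z hz
    obtain ⟨i, rfl⟩ : ∃ m, i = m + 1 := ⟨i - 1, by omega⟩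
    rw [hSrows] at hz
    have := hR.rigging_le _ z hz
    simp only [slack, vacancy, hshape] at this ⊢
    exact sub_nonneg.2 this
  have hunw := hits_two_eq_unwindingNumber a (n - a) hS0 hslack hx hxs hTrows hy hys
  have hQ2 := Q_removeRow (k := 2) (by omega) y.1 x.1 S
  simp only [Factor.deltaQ, length_tableau]
  have hdelta : (S.Q 2 y.1 : ℤ) - (S.removeRow x.1).Q 2 y.1 =
      unwindingNumber (T.tableau a (n - a) y.1) (S.tableau a (n - a) x.1) := by
    omega
  refine ⟨hdelta, fun hcoll => ?_⟩
  have hypos : 1 ≤ y.1 := by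
    have := Multiset.mem_of_le hcoll.1 (show y ∈ ({x, y} : Multiset (ℕ × ℤ)) by simp)
    rw [hSrows] at this
    exact hR.rows_pos _ _ this
  have hPq : (P.removeRows cs).quantum = P.shape 1 + Multiset.replicate L 1 := by
    refine quantum_removeRows cs (fun c hc => ?_) ?_
    · have hc : c ∈ R.shape (a - 1) := hcs ▸ Multiset.mem_coe.2 hc
      rcases Nat.eq_zero_or_pos (a - 1) with h | h
      · rw [h] at hc
        exact hR.quantum_pos c hc
      · obtain ⟨b, hb⟩ : ∃ b, a - 1 = b + 1 := ⟨a - 1 - 1, by omega⟩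
        rw [hb] at hc
        obtain ⟨z, hz, rfl⟩ := Multiset.mem_map.1 hc
        exact hR.rows_pos _ z hz
    · rw [hcs, ← add_assoc]
      rfl
  have hSq : S.quantum = S.shape 1 + Multiset.replicate d 1 := by
    rw [hS, quantum_removeRows_ones hd hPq, ← hS]
    change (P.rows 0).map Prod.fst + _ = (S.rows 0).map Prod.fst + _
    rw [hSrows]
    rfl
  have hxpos : 1 ≤ x.1 := by
    rw [hSrows] at hx
    exact hR.rows_pos _ _ hx
  obtain ⟨ν, hν⟩ := Multiset.exists_cons_of_mem hx
  have hν' : (S.removeRow x.1).rows 0 = ν := by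
    refine rows_removeRow_of_singular (r := x.2) x.1 ?_ fun _ => hxs
    rw [hν, if_neg (by omega), Multiset.singleton_add]
  have hS'q : (S.removeRow x.1).quantum =
      (S.removeRow x.1).shape 1 + Multiset.replicate d 1 := by
    refine quantum_removeRow x.1 ?_
    change S.quantum = _ + (((S.removeRow x.1).rows 0).map Prod.fst + _)
    rw [hSq, if_neg (by omega), hν']
    change (S.rows 0).map Prod.fst + _ = _
    rw [hν, Multiset.map_cons, ← Multiset.singleton_add, add_assoc]
  have hTshape : ∀ i, T.shape (i + 1) = (S.removeRow x.1).shape (i + 1) := by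
    intro i
    change (T.rows i).map Prod.fst = ((S.removeRow x.1).rows i).map Prod.fst
    rw [hTrows]
  have hTq : T.quantum = T.shape 1 + Multiset.replicate e 1 := by
    rw [hT, quantum_removeRows_ones he hS'q, ← hT, hTshape]
  have hvS := vacancy_zero_eq hSq hypos
  have hvT := vacancy_zero_eq hTq hypos
  -- The row of width `y.1` keeps its rigging, so its two vacancy numbers agree.
  have hvac : vacancy S.shape 0 y.1 = vacancy T.shape 0 y.1 := hcoll.2.2.symm.trans hys
  have hQ1 := Q_removeRow (k := 1) le_rfl y.1 x.1 S
  rw [hits_one_of_singular y.1 x.1 (r := x.2) fun _ => ⟨hx, hxs⟩] at hQ1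
  have hen := energy_add_unwindingNumber (T.tableau a (n - a) y.1) (S.tableau a (n - a) x.1)
  rw [length_tableau, length_tableau] at hen
  have h1 : T.Q 1 y.1 = (S.removeRow x.1).Q 1 y.1 := by rw [Q, Q, hTshape]
  have h2 : T.Q 2 y.1 = (S.removeRow x.1).Q 2 y.1 := by rw [Q, Q, hTshape]
  omega
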